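/- Let $C\subset\mathbb{R}^3$ be a solid right circular cylinder of radius $r>0$ and height $h>0$, and let $\theta\ge 0$. Let $d_2$ be a diameter of the bottom disk of $C$, and let $d_1$ be the diameter of the top disk obtained from $d_2$ by moving it up by $h$ and rotating it about the axis by the angle $\theta$. Let $h_1,h_2$ be the double helix of rotation angle $\theta$ joining the endpoints of $d_2$ to those of $d_1$: $h_1$ and $h_2$ are the two paths on the side of $C$ traced by the endpoints of $d_2$ when it moves up through the height $h$ at constant speed while turning about the axis at constant speed through the total angle $\theta$ (vertical segments if $\theta=0$). Let $H_C^\theta$ be the compact piece of helicoid (a planar rectangle if $\theta=0$) swept out by the diameter during this screw motion; in coordinates in which $d_2=\{(t,0,0):|t|\le r\}$ and the axis is the $z$-axis, $$H_C^\theta=\{(\rho\cos\theta s,\ \rho\sin\theta s,\ hs): |\rho|\le r,\ 0\le s\le 1\}.$$ Let $\Sigma\subset C$ be a compact immersed minimal surface of arbitrary topological type with $\partial\Sigma=d_1\cup d_2\cup h_1\cup h_2$; that is, $\Sigma$ is the image of a compact surface $M$ with boundary (and possibly corners) under a continuous map which is, in the interior of $M$, a $C^2$ immersion with zero mean curvature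 and which maps $\partial M$ onto $d_1\cup d_2\cup h_1\cup h_2$. If $0\le\theta\le h/r$, then $\Sigma=H_C^\theta$. -/

import Mathlib

open scoped Manifold ContDiff

noncomputable section

/-- Euclidean three-space. -/
abbrev E3 : Type := EuclideanSpace ℝ (Fin 3)

/-- The Euclidean plane, on which surfaces are modelled. -/
abbrev E2 : Type := EuclideanSpace ℝ (Fin 2)

/-! ### Minimal surfaces -/

/-- First partial derivative `X_i` of a parametrization `X` at `u`. -/
def partialDeriv (X : E2 → E3) (u : E2) (i : Fin 2) : E3 :=
  fderiv ℝ X u (EuclideanSpace.single i 1)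

/-- Second partial derivative `X_{ij}` of a parametrization `X` at `u`. -/
def partialDeriv₂ (X : E2 → E3) (u : E2) (i j : Fin 2) : E3 :=
  fderiv ℝ (fun v => partialDeriv X v j) u (EuclideanSpace.single i 1)

/-- Coefficients `g_{ij} = ⟨X_i, X_j⟩` of the first fundamental form. -/
def firstForm (X : E2 → E3) (u : E2) (i j : Fin 2) : ℝ :=
  inner ℝ (partialDeriv X u i) (partialDeriv X u j)

/-- The tangent plane of the parametrized surface `X` at `u`, as a linear subspace. -/
def tangentPlane (X : E2 → E3) (u : E2) : Submodule ℝ E3 :=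
  Submodule.span ℝ (Set.range (partialDeriv X u))

/-- Second fundamental form `b_{ij}` with values in the normal line: the component of `X_{ij}`
orthogonal to the tangent plane. For a unit normal `N` it is `⟨X_{ij}, N⟩ N`. -/
def secondForm (X : E2 → E3) (u : E2) (i j : Fin 2) : E3 :=
  (tangentPlane X u)ᗮ.starProjection (partialDeriv₂ X u i j)

/-- The mean curvature vector
`(1/2) (g₂₂ b₁₁ - 2 g₁₂ b₁₂ + g₁₁ b₂₂) / (g₁₁ g₂₂ - g₁₂²)` of the parametrized surface `X`
(for `X` an immersion at `u`). It does not depend on the orientation. -/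
def meanCurvatureVector (X : E2 → E3) (u : E2) : E3 :=
  (2 * (firstForm X u 0 0 * firstForm X u 1 1 - firstForm X u 0 1 ^ 2))⁻¹ •
    (firstForm X u 1 1 • secondForm X u 0 0
      - (2 * firstForm X u 0 1) • secondForm X u 0 1
      + firstForm X u 0 0 • secondForm X u 1 1)

/-- `f : M → ℝ³` is a minimal surface, where `M` is a surface with boundary (and possibly
corners): `f` is continuous on `M`, and on the interior of `M` it is a `C²` immersion whose mean
curvature vanishes. Nothing beyond continuity is required at the boundary. -/
structure IsMinimalSurface {H : Type*} [TopologicalSpace H] (I : ModelWithCorners ℝ E2 H)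
    {M : Type*} [TopologicalSpace M] [ChartedSpace H M] (f : M → E3) : Prop where
  continuous : Continuous f
  contMDiffAt : ∀ x ∈ I.interior M, ContMDiffAt I 𝓘(ℝ, E3) 2 f x
  immersion : ∀ x ∈ I.interior M, Function.Injective (mfderiv I 𝓘(ℝ, E3) f x)
  meanCurvature_eq_zero : ∀ x ∈ I.interior M,
    meanCurvatureVector (f ∘ (extChartAt I x).symm) (extChartAt I x x) = 0

/-! ### The cylinder and the helicoid

A right circular cylinder is placed in space by the centre `o` of its bottom disk and an
orthonormal basis `b`: the axis has direction `b 2`, and `b 0` is the direction of the diameter of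
the bottom disk. Both orientations of `b`, hence both senses of rotation, are allowed. -/

/-- The point with cylindrical coordinates `(ρ, α, z)` in the frame `(o, b)`. -/
def cylPoint (o : E3) (b : OrthonormalBasis (Fin 3) ℝ E3) (ρ α z : ℝ) : E3 :=
  o + (ρ * Real.cos α) • b 0 + (ρ * Real.sin α) • b 1 + z • b 2

/-- The solid cylinder `C` of radius `r` and height `h`. -/
def solidCylinder (o : E3) (b : OrthonormalBasis (Fin 3) ℝ E3) (r h : ℝ) : Set E3 :=
  {p | inner ℝ (b 0) (p - o) ^ 2 + inner ℝ (b 1) (p - o) ^ 2 ≤ r ^ 2 ∧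
    0 ≤ inner ℝ (b 2) (p - o) ∧ inner ℝ (b 2) (p - o) ≤ h}

/-- The complete helicoid ruled by the lines perpendicular to the axis that turn by the angle `θ`
over the height `h`. For `θ = 0` it is a plane. -/
def helicoid (o : E3) (b : OrthonormalBasis (Fin 3) ℝ E3) (h θ : ℝ) : Set E3 :=
  {p | ∃ ρ s : ℝ, p = cylPoint o b ρ (θ * s) (h * s)}

/-- The compact helicoid `H_C^θ`, the part of the helicoid in the cylinder. -/
def compactHelicoid (o : E3) (b : OrthonormalBasis (Fin 3) ℝ E3) (r h θ : ℝ) : Set E3 :=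
  helicoid o b h θ ∩ solidCylinder o b r h

/-- The diameter of the disk of radius `r` at height `z` in the direction of angle `α`. -/
def diameter (o : E3) (b : OrthonormalBasis (Fin 3) ℝ E3) (r α z : ℝ) : Set E3 :=
  (fun t => cylPoint o b t α z) '' Set.Icc (-r) r

/-- The helix on the side of the cylinder which rises from the bottom to the top at a constant
rate, starts at angle `α` and has rotation angle `θ`. -/
def helix (o : E3) (b : OrthonormalBasis (Fin 3) ℝ E3) (r h α θ : ℝ) : Set E3 :=
  (fun s => cylPoint o b r (α + θ * s) (h * s)) '' Set.Icc 0 1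

/-- The contour `d₁ ∪ d₂ ∪ h₁ ∪ h₂`: the top diameter, the bottom diameter, and the double helix of
rotation angle `θ` (two helices symmetric about the axis) joining their endpoints. -/
def helicalContour (o : E3) (b : OrthonormalBasis (Fin 3) ℝ E3) (r h θ : ℝ) : Set E3 :=
  diameter o b r θ h ∪ diameter o b r 0 0 ∪ helix o b r h 0 θ ∪ helix o b r h Real.pi θ

end

/-!
By the convex hull property of minimal surfaces, `Σ` lies in the cylinder. Let `u` be the coordinate
across the rulings of the helicoid, so that the helicoid is `{u = 0}`, let `ρ` be the distance from
the axis and `a` the rotation per unit of height. As `(a r)² < 2`, there is an `l` with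
`a² / 2 < l < 1 / r²`. If, for a sign `σ`, the quotient `σ u / (1 - l ρ²)` had a positive maximum
`c` on `Σ`, then `Φ = σ u + c l ρ²` would be maximal at the same interior point, where the trace of
the Hessian of `Φ` on the tangent plane of `Σ` is a positive multiple of `2 c l - a² σ u > 0`: a
contradiction. Both signs of `σ` together give `u = 0` on `Σ`.

On the helicoid, arclength along the ruling and height are global coordinates. In them `f` is a
local homeomorphism on the interior of `M` and sends `∂M` to the boundary of the rectangle
`[-r, r] × [0, h]`, so the image is open and closed in the open rectangle, hence all of it.
-/

/-! ### Second variation at a maximum on a minimal surface -/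

open Filter Topology in
theorem second_deriv_nonpos_of_isLocalMax {φ φ' : ℝ → ℝ} {t₀ s : ℝ} (hmax : IsLocalMax φ t₀)
    (hφ : ∀ᶠ t in 𝓝 t₀, HasDerivAt φ (φ' t) t) (hφ' : HasDerivAt φ' s t₀) : s ≤ 0 := by
  by_contra! hs
  have hd : deriv φ =ᶠ[𝓝 t₀] φ' := hφ.mono fun t ht => ht.deriv
  have hdd : deriv (deriv φ) t₀ = s := by rw [hd.deriv_eq, hφ'.deriv]
  have hmin : IsLocalMin φ t₀ :=
    isLocalMin_of_deriv_deriv_pos (by rwa [hdd]) hmax.deriv_eq_zero hφ.self_of_nhds.continuousAt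
  have hconst : φ =ᶠ[𝓝 t₀] fun _ => φ t₀ := by
    filter_upwards [hmax, hmin] with t hle hge using le_antisymm hle hge
  have hzero : deriv (deriv φ) t₀ = 0 := by
    rw [hconst.deriv.deriv_eq, deriv_const', deriv_const]
  exact hs.ne' (hdd.symm.trans hzero)

open Filter Topology in
theorem first_second_variation_of_isLocalMax {E F : Type*} [NormedAddCommGroup E] [NormedSpace ℝ E]
    [NormedAddCommGroup F] [InnerProductSpace ℝ F] [CompleteSpace F] {X : E → F} {u : E}
    (hX : ContDiffAt ℝ 2 X u) {Φ : F → ℝ} {G : F → F} {A : F →L[ℝ] F}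
    (hΦ : ∀ p, HasGradientAt Φ (G p) p) (hG : HasFDerivAt G A (X u))
    (hmax : IsLocalMax (Φ ∘ X) u) (d : E) :
    inner ℝ (G (X u)) (fderiv ℝ X u d) = 0 ∧
      inner ℝ (A (fderiv ℝ X u d)) (fderiv ℝ X u d)
        + inner ℝ (G (X u)) (fderiv ℝ (fderiv ℝ X) u d d) ≤ 0 := by
  have hu : u + (0 : ℝ) • d = u := by rw [zero_smul, add_zero]
  have hline (t : ℝ) : HasDerivAt (fun t : ℝ => u + t • d) d t := by
    simpa only [one_smul, id_eq] using ((hasDerivAt_id t).smul_const d).const_add u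
  have htend : Tendsto (fun t : ℝ => u + t • d) (𝓝 0) (𝓝 u) := by
    simpa only [hu] using (hline 0).continuousAt.tendsto
  have hdiff : ∀ᶠ v in 𝓝 u, DifferentiableAt ℝ X v :=
    (hX.eventually (by simp)).mono fun v hv => hv.differentiableAt (by simp)
  have hφ : ∀ᶠ t in 𝓝 (0 : ℝ), HasDerivAt (fun t : ℝ => Φ (X (u + t • d)))
      (inner ℝ (G (X (u + t • d))) (fderiv ℝ X (u + t • d) d)) t := by
    filter_upwards [htend.eventually hdiff] with t ht
    exact (hΦ _).hasFDerivAt.comp_hasDerivAt t (ht.hasFDerivAt.comp_hasDerivAt t (hline t))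
  have hmaxφ : IsLocalMax (fun t : ℝ => Φ (X (u + t • d))) 0 := by
    filter_upwards [htend.eventually hmax] with t ht
    simpa only [Function.comp_apply, hu] using ht
  have hdX : HasDerivAt (fun t : ℝ => X (u + t • d)) (fderiv ℝ X u d) 0 :=
    hdiff.self_of_nhds.hasFDerivAt.comp_hasDerivAt_of_eq 0 (hline 0) hu.symm
  have hddX : HasDerivAt (fun t : ℝ => fderiv ℝ X (u + t • d) d)
      (fderiv ℝ (fderiv ℝ X) u d d) 0 := by
    have h := ((hX.fderiv_right (m := 1) (by norm_num)).differentiableAt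
      (by simp)).hasFDerivAt.comp_hasDerivAt_of_eq 0 (hline 0) hu.symm
    simpa using h.clm_apply (hasDerivAt_const (0 : ℝ) d)
  have hdG : HasDerivAt (fun t : ℝ => G (X (u + t • d))) (A (fderiv ℝ X u d)) 0 :=
    hG.comp_hasDerivAt_of_eq 0 hdX (congrArg X hu.symm)
  have hsecond := second_deriv_nonpos_of_isLocalMax hmaxφ hφ (hdG.inner ℝ hddX)
  simp only [hu] at hsecond
  exact ⟨by simpa only [hu] using hmaxφ.hasDerivAt_eq_zero hφ.self_of_nhds, by linarith⟩

theorem partialDeriv₂_eq_fderiv_fderiv {X : E2 → E3} {u : E2} (hX : ContDiffAt ℝ 2 X u)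
    (i j : Fin 2) :
    partialDeriv₂ X u i j =
      fderiv ℝ (fderiv ℝ X) u (EuclideanSpace.single i 1) (EuclideanSpace.single j 1) := by
  have h : DifferentiableAt ℝ (fderiv ℝ X) u :=
    (hX.fderiv_right (m := 1) (by norm_num)).differentiableAt (by simp)
  have h' := h.hasFDerivAt.clm_apply
    (hasFDerivAt_const (EuclideanSpace.single j (1 : ℝ) : E2) u)
  simp [partialDeriv₂, partialDeriv, h'.fderiv]

theorem firstForm_det_pos {X : E2 → E3} {u : E2} (hinj : Function.Injective (fderiv ℝ X u)) :
    0 < firstForm X u 0 0 * firstForm X u 1 1 - firstForm X u 0 1 ^ 2 := by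
  have hli : LinearIndependent ℝ (partialDeriv X u) := by
    have h := (EuclideanSpace.basisFun (Fin 2) ℝ).orthonormal.linearIndependent.map'
      (fderiv ℝ X u : E2 →ₗ[ℝ] E3) (LinearMap.ker_eq_bot.2 hinj)
    have hbasis : fderiv ℝ X u ∘ EuclideanSpace.basisFun (Fin 2) ℝ = partialDeriv X u := by
      ext1 i
      simp [partialDeriv]
    exact hbasis ▸ h
  have h := (Matrix.posDef_gram_of_linearIndependent hli).det_pos
  rw [Matrix.det_fin_two] at h
  simp only [Matrix.gram_apply] at h
  rw [real_inner_comm (partialDeriv X u 0) (partialDeriv X u 1)] at h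
  simpa only [firstForm, sq] using h

theorem inner_secondForm {X : E2 → E3} {u : E2} {n : E3} (hn : n ∈ (tangentPlane X u)ᗮ)
    (i j : Fin 2) : inner ℝ n (secondForm X u i j) = inner ℝ n (partialDeriv₂ X u i j) := by
  rw [secondForm, ← Submodule.inner_starProjection_left_eq_right,
    Submodule.starProjection_eq_self_iff.2 hn]

theorem mem_orthogonal_tangentPlane {X : E2 → E3} {u : E2} {n : E3}
    (hn : ∀ d, inner ℝ n (fderiv ℝ X u d) = 0) : n ∈ (tangentPlane X u)ᗮ := by
  have h : tangentPlane X u ≤ (ℝ ∙ n)ᗮ := Submodule.span_le.2 <| by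
    rintro _ ⟨i, rfl⟩
    exact Submodule.mem_orthogonal_singleton_iff_inner_right.2 (hn _)
  exact fun w hw => Submodule.mem_orthogonal_singleton_iff_inner_left.1 (h hw)

theorem sum_secondForm_eq_zero {X : E2 → E3} {u : E2} (hinj : Function.Injective (fderiv ℝ X u))
    (hH : meanCurvatureVector X u = 0) {n : E3} (hn : n ∈ (tangentPlane X u)ᗮ) :
    firstForm X u 1 1 * inner ℝ n (partialDeriv₂ X u 0 0)
      - 2 * firstForm X u 0 1 * inner ℝ n (partialDeriv₂ X u 0 1)
      + firstForm X u 0 0 * inner ℝ n (partialDeriv₂ X u 1 1) = 0 := by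
  rw [meanCurvatureVector, smul_eq_zero] at hH
  have hv := hH.resolve_left (inv_ne_zero (mul_pos two_pos (firstForm_det_pos hinj)).ne')
  simpa only [inner_add_right, inner_sub_right, real_inner_smul_right, inner_secondForm hn,
    inner_zero_right] using congrArg (inner ℝ n) hv

theorem orthonormal_gramSchmidt_pair {F : Type*} [NormedAddCommGroup F] [InnerProductSpace ℝ F]
    {v w : F} (hdet : 0 < inner ℝ v v * inner ℝ w w - inner ℝ v w ^ 2) :
    Orthonormal ℝ ![(√(inner ℝ v v))⁻¹ • v,
      (√(inner ℝ v v * (inner ℝ v v * inner ℝ w w - inner ℝ v w ^ 2)))⁻¹ •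
        (inner ℝ v v • w - inner ℝ v w • v)] := by
  have hv : 0 < inner ℝ v v := real_inner_self_pos.2 fun h => by simp [h] at hdet
  have hnorm : inner ℝ (inner ℝ v v • w - inner ℝ v w • v) (inner ℝ v v • w - inner ℝ v w • v)
      = inner ℝ v v * (inner ℝ v v * inner ℝ w w - inner ℝ v w ^ 2) := by
    simp only [inner_sub_left, inner_sub_right, real_inner_smul_left, real_inner_smul_right,
      real_inner_comm v w]
    ring
  have horth : inner ℝ v (inner ℝ v v • w - inner ℝ v w • v) = 0 := by
    simp only [inner_sub_right, real_inner_smul_right]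
    ring
  have hunit {q : F} {c : ℝ} (hc : 0 < c) (hq : inner ℝ q q = c) : ‖(√c)⁻¹ • q‖ = 1 := by
    rw [norm_smul, norm_inv, Real.norm_of_nonneg (Real.sqrt_nonneg c), ← hq,
      real_inner_self_eq_norm_sq, Real.sqrt_sq (norm_nonneg q), inv_mul_cancel₀]
    exact norm_ne_zero_iff.2 fun h => hc.ne (by simpa [h] using hq)
  refine orthonormal_vecCons_iff.2 ⟨hunit hv rfl, fun i => ?_,
    orthonormal_vecCons_iff.2 ⟨hunit (mul_pos hv hdet) hnorm, fun i => i.elim0, .of_isEmpty _⟩⟩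
  rw [Subsingleton.elim i 0, Matrix.cons_val_fin_one, real_inner_smul_left,
    real_inner_smul_right, horth, mul_zero, mul_zero]

theorem exists_orthonormal_tangent_frame {X : E2 → E3} {u : E2} (hX : ContDiffAt ℝ 2 X u)
    (hinj : Function.Injective (fderiv ℝ X u)) (hH : meanCurvatureVector X u = 0) :
    ∃ d : Fin 2 → E2, Orthonormal ℝ (fun i => fderiv ℝ X u (d i)) ∧
      ∀ n ∈ (tangentPlane X u)ᗮ, ∑ i, inner ℝ n (fderiv ℝ (fderiv ℝ X) u (d i) (d i)) = 0 := by
  set E := firstForm X u 0 0 with hE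
  set F := firstForm X u 0 1
  set G := firstForm X u 1 1
  set e₀ : E2 := EuclideanSpace.single 0 1
  set e₁ : E2 := EuclideanSpace.single 1 1
  have hdet : 0 < E * G - F ^ 2 := firstForm_det_pos hinj
  have hEpos : 0 < E := real_inner_self_pos.2 fun h => by
    rw [hE, firstForm, h, inner_zero_left, zero_mul] at hdet
    exact hdet.not_ge (sub_nonpos.2 (sq_nonneg F))
  -- The Gram–Schmidt process for the first fundamental form, applied to `e₀, e₁`.
  refine ⟨![(√E)⁻¹ • e₀, (√(E * (E * G - F ^ 2)))⁻¹ • (E • e₁ - F • e₀)], ?_, fun n hn => ?_⟩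
  · have himage : (fun i => fderiv ℝ X u (![(√E)⁻¹ • e₀,
          (√(E * (E * G - F ^ 2)))⁻¹ • (E • e₁ - F • e₀)] i))
        = ![(√E)⁻¹ • partialDeriv X u 0,
          (√(E * (E * G - F ^ 2)))⁻¹ • (E • partialDeriv X u 1 - F • partialDeriv X u 0)] := by
      funext i
      fin_cases i <;> simp [e₀, e₁, partialDeriv]
    exact himage ▸ orthonormal_gramSchmidt_pair hdet
  · have htrace := sum_secondForm_eq_zero hinj hH hn
    simp only [partialDeriv₂_eq_fderiv_fderiv hX] at htrace
    have hsymm : fderiv ℝ (fderiv ℝ X) u e₁ e₀ = fderiv ℝ (fderiv ℝ X) u e₀ e₁ :=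
      (hX.isSymmSndFDerivAt (by simp)).eq e₁ e₀
    rw [Fin.sum_univ_two]
    simp only [Matrix.cons_val_zero, Matrix.cons_val_one, map_smul, map_sub, smul_apply, sub_apply,
      inner_sub_right, real_inner_smul_right, hsymm]
    field_simp
    rw [Real.sq_sqrt hEpos.le, Real.sq_sqrt (mul_pos hEpos hdet).le]
    field_simp
    linear_combination E * htrace

theorem exists_orthonormalBasis_castSucc_eq {F : Type*} [NormedAddCommGroup F]
    [InnerProductSpace ℝ F] [FiniteDimensional ℝ F] {n : ℕ} (hF : Module.finrank ℝ F = n + 1)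
    {w : Fin n → F} (hw : Orthonormal ℝ w) :
    ∃ e : OrthonormalBasis (Fin (n + 1)) ℝ F, ∀ i, e i.castSucc = w i := by
  have hcomp : {i | i ≠ Fin.last n}.domRestrict (Fin.snoc w 0 : Fin (n + 1) → F)
      = w ∘ fun i => i.1.castPred i.2 := by
    ext1 ⟨i, hi⟩
    obtain ⟨j, rfl⟩ := Fin.exists_castSucc_eq.2 hi
    rw [Set.domRestrict_apply, Fin.snoc_castSucc, Function.comp_apply, Fin.castPred_castSucc]
  obtain ⟨e, he⟩ := Orthonormal.exists_orthonormalBasis_extension_of_card_eq (𝕜 := ℝ)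
    (hF.trans (Fintype.card_fin _).symm)
    (hcomp ▸ hw.comp _ fun i j hij => Subtype.ext (Fin.castPred_inj.1 hij))
  exact ⟨e, fun i => (he _ (Fin.castSucc_ne_last i)).trans (Fin.snoc_castSucc ..)⟩

theorem exists_unit_normal_trace_le_of_isLocalMax {X : E2 → E3} {u : E2}
    (hX : ContDiffAt ℝ 2 X u) (hinj : Function.Injective (fderiv ℝ X u))
    (hH : meanCurvatureVector X u = 0) {Φ : E3 → ℝ} {G : E3 → E3} {A : E3 →L[ℝ] E3}
    (hΦ : ∀ p, HasGradientAt Φ (G p) p) (hG : HasFDerivAt G A (X u))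
    (hmax : IsLocalMax (Φ ∘ X) u) :
    ∃ n : E3, ‖n‖ = 1 ∧ (∃ k : ℝ, G (X u) = k • n) ∧
      LinearMap.trace ℝ E3 (A : E3 →ₗ[ℝ] E3) ≤ inner ℝ n (A n) := by
  obtain ⟨d, hd, hmean⟩ := exists_orthonormal_tangent_frame hX hinj hH
  have hvar := first_second_variation_of_isLocalMax hX hΦ hG hmax
  obtain ⟨e, he⟩ := exists_orthonormalBasis_castSucc_eq finrank_euclideanSpace_fin hd
  have he₀ : e 0 = fderiv ℝ X u (d 0) := he 0
  have he₁ : e 1 = fderiv ℝ X u (d 1) := he 1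
  refine ⟨e 2, e.norm_eq_one 2, ⟨inner ℝ (e 2) (G (X u)), ?_⟩, ?_⟩
  · have hG₀ : inner ℝ (e 0) (G (X u)) = 0 := by rw [real_inner_comm, he₀, (hvar _).1]
    have hG₁ : inner ℝ (e 1) (G (X u)) = 0 := by rw [real_inner_comm, he₁, (hvar _).1]
    conv_lhs => rw [← e.sum_repr' (G (X u)), Fin.sum_univ_three, hG₀, hG₁]
    simp only [zero_smul, zero_add]
  · have hsum := hmean _ (mem_orthogonal_tangentPlane fun d => (hvar d).1)
    rw [Fin.sum_univ_two] at hsum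
    rw [LinearMap.trace_eq_sum_inner _ e, Fin.sum_univ_three]
    simp only [ContinuousLinearMap.coe_coe, he₀, he₁, real_inner_comm (A _)]
    linarith [(hvar (d 0)).2, (hvar (d 1)).2]

section MaximumPrinciple

variable {H : Type*} [TopologicalSpace H] {I : ModelWithCorners ℝ E2 H}
  {M : Type*} [TopologicalSpace M] [ChartedSpace H M] {f : M → E3}

theorem IsMinimalSurface.contDiffAt_chart (hmin : IsMinimalSurface I f) {x : M}
    (hx : x ∈ I.interior M) :
    ContDiffAt ℝ 2 (f ∘ (extChartAt I x).symm) (extChartAt I x x) := by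
  have h := (contMDiffAt_iff.1 (hmin.contMDiffAt x hx)).2
  simp only [extChartAt_model_space_eq_id, PartialEquiv.refl_coe, Function.id_comp] at h
  exact h.contDiffAt (range_mem_nhds_isInteriorPoint hx)

theorem IsMinimalSurface.injective_fderiv_chart (hmin : IsMinimalSurface I f) {x : M}
    (hx : x ∈ I.interior M) :
    Function.Injective (fderiv ℝ (f ∘ (extChartAt I x).symm) (extChartAt I x x)) := by
  have h := hmin.immersion x hx
  rw [((hmin.contMDiffAt x hx).mdifferentiableAt (by simp)).mfderiv] at h
  have h' : Function.Injective
      (fderivWithin ℝ (f ∘ (extChartAt I x).symm) (Set.range I) (extChartAt I x x)) := h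
  rwa [fderivWithin_of_mem_nhds (range_mem_nhds_isInteriorPoint hx)] at h'

theorem IsMinimalSurface.exists_unit_normal_trace_le_of_isLocalMax (hmin : IsMinimalSurface I f)
    {x : M} (hx : x ∈ I.interior M) {Φ : E3 → ℝ} {G : E3 → E3} {A : E3 →L[ℝ] E3}
    (hΦ : ∀ p, HasGradientAt Φ (G p) p) (hG : HasFDerivAt G A (f x))
    (hmax : IsLocalMax (Φ ∘ f) x) :
    ∃ n : E3, ‖n‖ = 1 ∧ (∃ k : ℝ, G (f x) = k • n) ∧
      LinearMap.trace ℝ E3 (A : E3 →ₗ[ℝ] E3) ≤ inner ℝ n (A n) := by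
  have hinv : (extChartAt I x).symm (extChartAt I x x) = x := extChartAt_to_inv x
  have hchart : IsLocalMax (Φ ∘ f ∘ (extChartAt I x).symm) (extChartAt I x x) := by
    have htend := (continuousAt_extChartAt_symm (I := I) x).tendsto
    rw [hinv] at htend
    filter_upwards [htend.eventually hmax] with y hy
    simpa only [Function.comp_apply, hinv] using hy
  have hfx : (f ∘ (extChartAt I x).symm) (extChartAt I x x) = f x := congrArg f hinv
  simpa only [hfx] using _root_.exists_unit_normal_trace_le_of_isLocalMax
    (hmin.contDiffAt_chart hx) (hmin.injective_fderiv_chart hx)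
    (hmin.meanCurvature_eq_zero x hx) hΦ (hfx ▸ hG) hchart

theorem hasGradientAt_add_mul_norm_sq {F : Type*} [NormedAddCommGroup F] [InnerProductSpace ℝ F]
    [CompleteSpace F] (ℓ : F →L[ℝ] ℝ) (ε : ℝ) (p : F) :
    HasGradientAt (fun p => ℓ p + ε * ‖p‖ ^ 2)
      ((InnerProductSpace.toDual ℝ F).symm ℓ + (2 * ε) • p) p := by
  rw [hasGradientAt_iff_hasFDerivAt]
  refine (ℓ.hasFDerivAt.add ((hasStrictFDerivAt_norm_sq p).hasFDerivAt.const_mul ε)).congr_fderiv ?_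
  ext ξ
  simp [mul_comm, mul_left_comm]

theorem IsMinimalSurface.not_isLocalMax_add_mul_norm_sq (hmin : IsMinimalSurface I f) {x : M}
    (hx : x ∈ I.interior M) (ℓ : E3 →L[ℝ] ℝ) {ε : ℝ} (hε : 0 < ε) :
    ¬ IsLocalMax (fun m => ℓ (f m) + ε * ‖f m‖ ^ 2) x := by
  intro hmax
  have hG : HasFDerivAt (fun p => (InnerProductSpace.toDual ℝ E3).symm ℓ + (2 * ε) • p)
      ((2 * ε) • ContinuousLinearMap.id ℝ E3) (f x) :=
    ((hasFDerivAt_id (f x)).const_smul (2 * ε)).const_add _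
  obtain ⟨n, hn, -, htrace⟩ := hmin.exists_unit_normal_trace_le_of_isLocalMax hx
    (hasGradientAt_add_mul_norm_sq ℓ ε) hG hmax
  have htrace' : 2 * ε * 3 ≤ 2 * ε := by
    simpa [hn, real_inner_smul_right] using htrace
  linarith

theorem IsMinimalSurface.le_of_le_on_boundary [CompactSpace M] (hmin : IsMinimalSurface I f)
    (ℓ : E3 →L[ℝ] ℝ) {c : ℝ} (hbd : ∀ x ∈ I.boundary M, ℓ (f x) ≤ c) (m : M) : ℓ (f m) ≤ c := by
  have hcont := hmin.continuous
  obtain ⟨K, hK⟩ := (isCompact_range (hcont.norm.pow 2)).bddAbove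
  have hK : ∀ y, ‖f y‖ ^ 2 ≤ K := fun y => hK ⟨y, rfl⟩
  have hbound {ε : ℝ} (hε : 0 < ε) : ℓ (f m) ≤ c + ε * K := by
    obtain ⟨x, -, hmax⟩ := isCompact_univ.exists_isMaxOn ⟨m, Set.mem_univ m⟩
      (f := fun m => ℓ (f m) + ε * ‖f m‖ ^ 2) (by fun_prop)
    have hx : x ∈ I.boundary M := by
      rw [← I.compl_interior]
      exact fun hx => hmin.not_isLocalMax_add_mul_norm_sq hx ℓ hε
        (hmax.isLocalMax Filter.univ_mem)
    calc ℓ (f m) ≤ ℓ (f m) + ε * ‖f m‖ ^ 2 := le_add_of_nonneg_right (by positivity)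
      _ ≤ ℓ (f x) + ε * ‖f x‖ ^ 2 := hmax (Set.mem_univ m)
      _ ≤ c + ε * K := add_le_add (hbd x hx) (mul_le_mul_of_nonneg_left (hK x) hε.le)
  have hlim : Filter.Tendsto (fun ε : ℝ => c + ε * K) (nhdsWithin 0 (Set.Ioi 0)) (nhds c) := by
    have h : Continuous fun ε : ℝ => c + ε * K := by fun_prop
    simpa using (h.tendsto 0).mono_left nhdsWithin_le_nhds
  exact ge_of_tendsto hlim (eventually_mem_nhdsWithin.mono fun _ => hbound)

theorem IsMinimalSurface.range_subset_of_convex [CompactSpace M] (hmin : IsMinimalSurface I f)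
    {K : Set E3} (hK : Convex ℝ K) (hKc : IsClosed K) (hbd : f '' I.boundary M ⊆ K) :
    Set.range f ⊆ K := by
  rintro _ ⟨m, rfl⟩
  by_contra hm
  obtain ⟨ℓ, c, hℓ, hc⟩ := geometric_hahn_banach_closed_point hK hKc hm
  exact hc.not_ge (hmin.le_of_le_on_boundary ℓ (fun x hx => (hℓ _ (hbd ⟨x, hx, rfl⟩)).le) m)

end MaximumPrinciple

/-! ### Coordinates adapted to a helicoid -/

theorem orthonormal_turned (b : OrthonormalBasis (Fin 3) ℝ E3) (φ : ℝ) :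
    Orthonormal ℝ ![Real.cos φ • b 0 + Real.sin φ • b 1, -Real.sin φ • b 0 + Real.cos φ • b 1,
      b 2] := by
  have hinner (x y x' y' : ℝ) :
      inner ℝ (x • b 0 + y • b 1) (x' • b 0 + y' • b 1) = x' * x + y' * y := by
    simp [inner_add_left, inner_add_right, real_inner_smul_left, real_inner_smul_right,
      b.inner_eq_ite]
  have hperp (x y : ℝ) : inner ℝ (x • b 0 + y • b 1) (b 2) = 0 := by
    simp [inner_add_left, real_inner_smul_left, b.inner_eq_ite]
  have hnorm {x y : ℝ} (hxy : x ^ 2 + y ^ 2 = 1) : ‖x • b 0 + y • b 1‖ = 1 := by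
    rw [norm_eq_sqrt_real_inner, hinner, ← sq, ← sq, hxy, Real.sqrt_one]
  have hrot : inner ℝ (Real.cos φ • b 0 + Real.sin φ • b 1)
      (-Real.sin φ • b 0 + Real.cos φ • b 1) = 0 := (hinner ..).trans (by ring)
  have hone : ∀ i : Fin 1, inner ℝ (-Real.sin φ • b 0 + Real.cos φ • b 1) (![b 2] i) = 0 :=
    fun i => Subsingleton.elim 0 i ▸ hperp _ _
  refine orthonormal_vecCons_iff.2 ⟨hnorm (Real.cos_sq_add_sin_sq φ),
    Fin.forall_fin_two.2 ⟨hrot, hperp _ _⟩, orthonormal_vecCons_iff.2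
      ⟨hnorm ((neg_sq (Real.sin φ)).symm ▸ Real.sin_sq_add_cos_sq φ), hone,
        orthonormal_vecCons_iff.2 ⟨b.norm_eq_one 2, fun i => i.elim0, .of_isEmpty _⟩⟩⟩

/-- The frame `b` turned about its last vector by the angle `φ`. -/
noncomputable def turnedFrame (b : OrthonormalBasis (Fin 3) ℝ E3) (φ : ℝ) :
    OrthonormalBasis (Fin 3) ℝ E3 :=
  .mk (orthonormal_turned b φ) (top_le_iff.2 <|
    (orthonormal_turned b φ).linearIndependent.span_eq_top_of_card_eq_finrank' (by simp))

section TurnedFrame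

variable (b : OrthonormalBasis (Fin 3) ℝ E3) (φ : ℝ)

theorem turnedFrame_zero : turnedFrame b φ 0 = Real.cos φ • b 0 + Real.sin φ • b 1 := by
  simp [turnedFrame]

theorem turnedFrame_one : turnedFrame b φ 1 = -Real.sin φ • b 0 + Real.cos φ • b 1 := by
  simp [turnedFrame]

theorem turnedFrame_two : turnedFrame b φ 2 = b 2 := by
  simp [turnedFrame]

theorem hasDerivAt_turnedFrame_zero :
    HasDerivAt (fun φ => turnedFrame b φ 0) (turnedFrame b φ 1) φ := by
  simp only [turnedFrame_zero, turnedFrame_one]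
  exact ((Real.hasDerivAt_cos φ).smul_const _).add ((Real.hasDerivAt_sin φ).smul_const _)

theorem hasDerivAt_turnedFrame_one :
    HasDerivAt (fun φ => turnedFrame b φ 1) (-turnedFrame b φ 0) φ := by
  simp only [turnedFrame_zero, turnedFrame_one, neg_add, ← neg_smul]
  exact ((Real.hasDerivAt_sin φ).neg.smul_const _).add ((Real.hasDerivAt_cos φ).smul_const _)

end TurnedFrame

section RulingCoordinates

variable (o : E3) (b : OrthonormalBasis (Fin 3) ℝ E3) (a : ℝ)

/-- The height of a point above the plane through `o` perpendicular to the axis `b 2`. -/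
noncomputable def height (p : E3) : ℝ := inner ℝ (b 2) (p - o)

/-- The frame which turns about the axis at rate `a` per unit of height, at the height of `p`: its
vector `0` directs the ruling, at that height, of the helicoid of rate `a`. -/
noncomputable def rulingFrame (p : E3) : OrthonormalBasis (Fin 3) ℝ E3 :=
  turnedFrame b (a * height o b p)

/-- The coordinate of `p` along the ruling at its height of the helicoid of rate `a`. -/
noncomputable def alongRuling (p : E3) : ℝ := inner ℝ (rulingFrame o b a p 0) (p - o)

/-- The horizontal coordinate of `p` across the ruling at its height of the helicoid of rate `a`;
the helicoid is its zero set. -/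
noncomputable def acrossRuling (p : E3) : ℝ := inner ℝ (rulingFrame o b a p 1) (p - o)

/-- The square of the distance of `p` from the axis. -/
noncomputable def axisDistSq (p : E3) : ℝ := ‖p - o‖ ^ 2 - height o b p ^ 2

variable {o b a}

theorem rulingFrame_two (p : E3) : rulingFrame o b a p 2 = b 2 := turnedFrame_two b _

theorem inner_rulingFrame_two (p : E3) : inner ℝ (rulingFrame o b a p 2) (p - o) = height o b p :=
  congrArg (inner ℝ · (p - o)) (rulingFrame_two p)

theorem inner_axis_rulingFrame {i : Fin 3} (hi : i ≠ 2) (p : E3) :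
    inner ℝ (b 2) (rulingFrame o b a p i) = 0 := by
  rw [← rulingFrame_two (o := o) (a := a) p]
  exact (rulingFrame o b a p).inner_eq_zero hi.symm

theorem axisDistSq_eq_inner_sq (p : E3) :
    axisDistSq o b p = inner ℝ (b 0) (p - o) ^ 2 + inner ℝ (b 1) (p - o) ^ 2 := by
  rw [axisDistSq, height, ← b.sum_sq_inner_right (p - o), Fin.sum_univ_three, add_sub_cancel_right]

theorem axisDistSq_eq_along_sq_add_across_sq (p : E3) :
    axisDistSq o b p = alongRuling o b a p ^ 2 + acrossRuling o b a p ^ 2 := by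
  rw [axisDistSq, ← (rulingFrame o b a p).sum_sq_inner_right (p - o), Fin.sum_univ_three,
    inner_rulingFrame_two, add_sub_cancel_right, alongRuling, acrossRuling]

theorem hasFDerivAt_height (p : E3) : HasFDerivAt (height o b) (innerSL ℝ (b 2)) p :=
  (innerSL ℝ (b 2)).hasFDerivAt.comp p ((hasFDerivAt_id p).sub_const o)

theorem hasFDerivAt_rulingFrame_zero (p : E3) :
    HasFDerivAt (fun p => rulingFrame o b a p 0)
      ((a • innerSL ℝ (b 2)).smulRight (rulingFrame o b a p 1)) p :=
  HasFDerivAt.comp (g := fun φ => turnedFrame b φ 0) p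
    (hasDerivAt_turnedFrame_zero b _).hasFDerivAt ((hasFDerivAt_height p).const_mul a)

theorem hasFDerivAt_rulingFrame_one (p : E3) :
    HasFDerivAt (fun p => rulingFrame o b a p 1)
      ((a • innerSL ℝ (b 2)).smulRight (-rulingFrame o b a p 0)) p :=
  HasFDerivAt.comp (g := fun φ => turnedFrame b φ 1) p
    (hasDerivAt_turnedFrame_one b _).hasFDerivAt ((hasFDerivAt_height p).const_mul a)

theorem hasGradientAt_alongRuling (p : E3) :
    HasGradientAt (alongRuling o b a)
      (rulingFrame o b a p 0 + (a * acrossRuling o b a p) • b 2) p := by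
  rw [hasGradientAt_iff_hasFDerivAt]
  refine ((hasFDerivAt_rulingFrame_zero p).inner ℝ
    ((hasFDerivAt_id p).sub_const o)).congr_fderiv ?_
  ext ξ
  simp only [id_eq, ContinuousLinearMap.comp_apply, ContinuousLinearMap.prod_apply,
    ContinuousLinearMap.smulRight_apply, smul_apply, coe_innerSL_apply, smul_eq_mul,
    ContinuousLinearMap.id_apply, fderivInnerCLM_apply, real_inner_smul_left, acrossRuling, map_add,
    map_smul, add_apply, InnerProductSpace.toDual_apply_apply]
  ring

theorem hasGradientAt_acrossRuling (p : E3) :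
    HasGradientAt (acrossRuling o b a)
      (rulingFrame o b a p 1 - (a * alongRuling o b a p) • b 2) p := by
  rw [hasGradientAt_iff_hasFDerivAt]
  refine ((hasFDerivAt_rulingFrame_one p).inner ℝ
    ((hasFDerivAt_id p).sub_const o)).congr_fderiv ?_
  ext ξ
  simp only [id_eq, ContinuousLinearMap.comp_apply, ContinuousLinearMap.prod_apply,
    ContinuousLinearMap.smulRight_apply, smul_apply, coe_innerSL_apply, smul_eq_mul, smul_neg,
    ContinuousLinearMap.id_apply, fderivInnerCLM_apply, inner_neg_left, real_inner_smul_left,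
    alongRuling, map_sub, map_smul, sub_apply, InnerProductSpace.toDual_apply_apply]
  ring

theorem hasGradientAt_axisDistSq (p : E3) :
    HasGradientAt (axisDistSq o b) ((2 : ℝ) • (p - o - height o b p • b 2)) p := by
  rw [hasGradientAt_iff_hasFDerivAt]
  refine (((hasFDerivAt_id p).sub_const o).norm_sq.sub
    ((hasFDerivAt_height p).pow 2)).congr_fderiv ?_
  ext ξ
  simp only [id_eq, map_sub, ContinuousLinearMap.comp_id, Nat.add_one_sub_one, pow_one,
    nsmul_eq_mul, Nat.cast_ofNat, sub_apply, smul_apply, coe_innerSL_apply, smul_eq_mul, map_smul,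
    InnerProductSpace.toDual_apply_apply]
  ring

theorem continuous_acrossRuling : Continuous (acrossRuling o b a) :=
  continuous_iff_continuousAt.2 fun p => (hasGradientAt_acrossRuling p).continuousAt

theorem continuous_axisDistSq : Continuous (axisDistSq o b) :=
  continuous_iff_continuousAt.2 fun p => (hasGradientAt_axisDistSq p).continuousAt

end RulingCoordinates

/-! ### The barrier -/

section Barrier

variable (o : E3) (b : OrthonormalBasis (Fin 3) ℝ E3) (a σ μ : ℝ)

/-- The barrier `σ u + μ ρ² / 2`, with `u` the coordinate across the rulings of the helicoid of
rate `a` and `ρ` the distance from the axis. -/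
noncomputable def rulingBarrier (p : E3) : ℝ := σ * acrossRuling o b a p + μ / 2 * axisDistSq o b p

/-- The gradient of `rulingBarrier`. -/
noncomputable def rulingBarrierGrad (p : E3) : E3 :=
  σ • (rulingFrame o b a p 1 - (a * alongRuling o b a p) • b 2) + μ • (p - o - height o b p • b 2)

/-- The Hessian of `rulingBarrier`, as a symmetric operator. -/
noncomputable def rulingBarrierHess (p : E3) : E3 →L[ℝ] E3 :=
  σ • ((a • innerSL ℝ (b 2)).smulRight (-rulingFrame o b a p 0)
      - (a • innerSL ℝ (rulingFrame o b a p 0 + (a * acrossRuling o b a p) • b 2)).smulRight (b 2))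
    + μ • (ContinuousLinearMap.id ℝ E3 - (innerSL ℝ (b 2)).smulRight (b 2))

variable {o b a σ μ}

theorem hasGradientAt_rulingBarrier (p : E3) :
    HasGradientAt (rulingBarrier o b a σ μ) (rulingBarrierGrad o b a σ μ p) p := by
  rw [hasGradientAt_iff_hasFDerivAt]
  refine (((hasGradientAt_acrossRuling p).hasFDerivAt.const_mul σ).add
    ((hasGradientAt_axisDistSq p).hasFDerivAt.const_mul (μ / 2))).congr_fderiv ?_
  ext ξ
  simp only [map_sub, map_smul, add_apply, smul_apply, sub_apply,
    InnerProductSpace.toDual_apply_apply, smul_eq_mul, rulingBarrierGrad, map_add]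
  ring

theorem hasFDerivAt_rulingBarrierGrad (p : E3) :
    HasFDerivAt (rulingBarrierGrad o b a σ μ) (rulingBarrierHess o b a σ μ p) p :=
  (((hasFDerivAt_rulingFrame_one p).sub
      (((hasGradientAt_alongRuling p).hasFDerivAt.const_mul a).smul_const (b 2))).const_smul σ).add
    ((((hasFDerivAt_id p).sub_const o).sub
      ((hasFDerivAt_height p).smul_const (b 2))).const_smul μ)

theorem inner_rulingBarrierGrad (p : E3) :
    inner ℝ (rulingFrame o b a p 0) (rulingBarrierGrad o b a σ μ p) = μ * alongRuling o b a p ∧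
    inner ℝ (rulingFrame o b a p 1) (rulingBarrierGrad o b a σ μ p)
      = σ + μ * acrossRuling o b a p ∧
    inner ℝ (b 2) (rulingBarrierGrad o b a σ μ p) = -(σ * (a * alongRuling o b a p)) := by
  have hv : inner ℝ (rulingFrame o b a p 0) (p - o) = alongRuling o b a p := rfl
  have hu : inner ℝ (rulingFrame o b a p 1) (p - o) = acrossRuling o b a p := rfl
  have hz : inner ℝ (b 2) (p - o) = height o b p := rfl
  have h₀ : inner ℝ (rulingFrame o b a p 0) (b 2) = 0 := by
    rw [real_inner_comm, inner_axis_rulingFrame (by decide)]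
  have h₁ : inner ℝ (rulingFrame o b a p 1) (b 2) = 0 := by
    rw [real_inner_comm, inner_axis_rulingFrame (by decide)]
  refine ⟨?_, ?_, ?_⟩ <;>
    simp only [rulingBarrierGrad, inner_add_right, inner_sub_right _ _ (_ • _),
      real_inner_smul_right, OrthonormalBasis.inner_eq_ite, hv, hu, hz,
      inner_axis_rulingFrame (show (1 : Fin 3) ≠ 2 by decide), h₀, h₁] <;>
    simp

theorem inner_rulingBarrierHess (p ξ : E3) :
    inner ℝ ξ (rulingBarrierHess o b a σ μ p ξ)
      = σ * (-2 * a * inner ℝ (b 2) ξ * inner ℝ (rulingFrame o b a p 0) ξ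
          - a ^ 2 * acrossRuling o b a p * inner ℝ (b 2) ξ ^ 2)
        + μ * (‖ξ‖ ^ 2 - inner ℝ (b 2) ξ ^ 2) := by
  simp only [rulingBarrierHess, map_add, map_smul, add_apply, smul_apply, sub_apply,
    ContinuousLinearMap.smulRight_apply, coe_innerSL_apply, real_inner_comm ξ, smul_eq_mul,
    ContinuousLinearMap.id_apply, inner_add_right, real_inner_smul_right, inner_sub_right,
    inner_neg_right, real_inner_self_eq_norm_sq]
  ring

theorem trace_rulingBarrierHess (p : E3) :
    LinearMap.trace ℝ E3 (rulingBarrierHess o b a σ μ p : E3 →ₗ[ℝ] E3)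
      = 2 * μ - a ^ 2 * (σ * acrossRuling o b a p) := by
  rw [LinearMap.trace_eq_sum_inner _ (rulingFrame o b a p), Fin.sum_univ_three]
  simp only [ContinuousLinearMap.coe_coe, inner_rulingBarrierHess,
    ← rulingFrame_two (o := o) (b := b) (a := a) p, OrthonormalBasis.inner_eq_ite,
    OrthonormalBasis.norm_eq_one, Fin.reduceEq, if_true, if_false]
  ring

/- Up to the factor `‖∇Φ‖ ^ 3`, the left-hand side is the mean curvature of the level set of the
barrier `Φ`. -/
theorem norm_sq_mul_trace_sub_inner_rulingBarrierHess (p : E3) :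
    ‖rulingBarrierGrad o b a σ μ p‖ ^ 2
        * LinearMap.trace ℝ E3 (rulingBarrierHess o b a σ μ p : E3 →ₗ[ℝ] E3)
      - inner ℝ (rulingBarrierGrad o b a σ μ p)
        (rulingBarrierHess o b a σ μ p (rulingBarrierGrad o b a σ μ p))
      = (μ - a ^ 2 * (σ * acrossRuling o b a p))
        * ((μ * alongRuling o b a p) ^ 2 + (σ + μ * acrossRuling o b a p) ^ 2) := by
  obtain ⟨h₀, h₁, h₂⟩ := inner_rulingBarrierGrad (o := o) (b := b) (a := a) (σ := σ) (μ := μ) p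
  rw [trace_rulingBarrierHess, inner_rulingBarrierHess,
    ← (rulingFrame o b a p).sum_sq_inner_right (rulingBarrierGrad o b a σ μ p), Fin.sum_univ_three,
    rulingFrame_two, h₀, h₁, h₂]
  ring

end Barrier

section Comparison

variable {H : Type*} [TopologicalSpace H] {I : ModelWithCorners ℝ E2 H}
  {M : Type*} [TopologicalSpace M] [ChartedSpace H M] {f : M → E3}
  {o : E3} {b : OrthonormalBasis (Fin 3) ℝ E3} {a : ℝ}

theorem IsMinimalSurface.not_isLocalMax_rulingBarrier (hmin : IsMinimalSurface I f) {x : M}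
    (hx : x ∈ I.interior M) {σ μ : ℝ} (hu : 0 < σ * acrossRuling o b a (f x))
    (hμ : a ^ 2 * (σ * acrossRuling o b a (f x)) < μ) :
    ¬ IsLocalMax (rulingBarrier o b a σ μ ∘ f) x := by
  intro hmax
  obtain ⟨n, hn, ⟨k, hk⟩, htrace⟩ := hmin.exists_unit_normal_trace_le_of_isLocalMax hx
    hasGradientAt_rulingBarrier (hasFDerivAt_rulingBarrierGrad (f x)) hmax
  have hid := norm_sq_mul_trace_sub_inner_rulingBarrierHess (o := o) (b := b) (a := a) (σ := σ)
    (μ := μ) (f x)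
  simp only [hk, norm_smul, hn, mul_one, Real.norm_eq_abs, sq_abs, map_smul, real_inner_smul_left,
    real_inner_smul_right] at hid
  have hμpos : 0 < μ := (mul_nonneg (sq_nonneg a) hu.le).trans_lt hμ
  have hcoeff : σ + μ * acrossRuling o b a (f x) ≠ 0 := fun h => by
    have hσ : σ ^ 2 + μ * (σ * acrossRuling o b a (f x)) = 0 := by linear_combination σ * h
    exact (add_pos_of_nonneg_of_pos (sq_nonneg σ) (mul_pos hμpos hu)).ne' hσ
  have hpos := mul_pos (sub_pos.2 hμ)
    (add_pos_of_nonneg_of_pos (sq_nonneg (μ * alongRuling o b a (f x))) (sq_pos_of_ne_zero hcoeff))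
  rw [← hid] at hpos
  linarith [mul_le_mul_of_nonneg_left htrace (sq_nonneg k)]

theorem IsMinimalSurface.mul_acrossRuling_nonpos [CompactSpace M] (hmin : IsMinimalSurface I f)
    {l : ℝ} (ha : a ^ 2 < 2 * l) (hl : ∀ m, l * axisDistSq o b (f m) < 1)
    (hbd : ∀ m ∈ I.boundary M, acrossRuling o b a (f m) = 0) (σ : ℝ) (m : M) :
    σ * acrossRuling o b a (f m) ≤ 0 := by
  have hden (y : M) : 0 < 1 - l * axisDistSq o b (f y) := sub_pos.2 (hl y)
  have hf := hmin.continuous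
  have hu := continuous_acrossRuling (o := o) (b := b) (a := a)
  have hρ := continuous_axisDistSq (o := o) (b := b)
  obtain ⟨x, -, hx⟩ := isCompact_univ.exists_isMaxOn ⟨m, Set.mem_univ m⟩
    (f := fun y => σ * acrossRuling o b a (f y) / (1 - l * axisDistSq o b (f y)))
    (Continuous.div (by fun_prop) (by fun_prop) fun y => (hden y).ne').continuousOn
  set c := σ * acrossRuling o b a (f x) / (1 - l * axisDistSq o b (f x)) with hc
  have hle (y : M) : σ * acrossRuling o b a (f y) ≤ c * (1 - l * axisDistSq o b (f y)) :=
    (div_le_iff₀ (hden y)).1 (hx (Set.mem_univ y))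
  have heq : σ * acrossRuling o b a (f x) = c * (1 - l * axisDistSq o b (f x)) :=
    (div_mul_cancel₀ _ (hden x).ne').symm
  refine (hle m).trans (mul_nonpos_of_nonpos_of_nonneg (not_lt.1 fun hcpos => ?_) (hden m).le)
  have hxint : x ∈ I.interior M := by
    rw [← I.compl_boundary]
    exact fun hxb => hcpos.ne' (by rw [hc, hbd x hxb, mul_zero, zero_div])
  have hlρ : 0 ≤ l * axisDistSq o b (f x) := by
    have hlpos : 0 ≤ l := by linarith [sq_nonneg a]
    rw [axisDistSq_eq_inner_sq]
    positivity
  -- The maximum of `σ u / (1 - l ρ²)` is `c`, so `σ u + c l ρ² ≤ c` with equality at `x`.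
  refine hmin.not_isLocalMax_rulingBarrier hxint (σ := σ) (μ := 2 * (c * l)) (o := o) (b := b)
    (a := a) (heq ▸ mul_pos hcpos (hden x)) ?_ (.of_forall fun y => ?_)
  · calc a ^ 2 * (σ * acrossRuling o b a (f x))
        ≤ a ^ 2 * c := by
          rw [heq]
          exact mul_le_mul_of_nonneg_left (mul_le_of_le_one_right hcpos.le (by linarith))
            (sq_nonneg a)
      _ < 2 * l * c := mul_lt_mul_of_pos_right ha hcpos
      _ = 2 * (c * l) := by ring
  · simp only [Function.comp_apply, rulingBarrier]
    linarith [hle y]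

theorem IsMinimalSurface.acrossRuling_eq_zero [CompactSpace M] (hmin : IsMinimalSurface I f)
    {r : ℝ} (har : (a * r) ^ 2 < 2) (hr : ∀ m, axisDistSq o b (f m) ≤ r ^ 2)
    (hbd : ∀ m ∈ I.boundary M, acrossRuling o b a (f m) = 0) (m : M) :
    acrossRuling o b a (f m) = 0 := by
  obtain ⟨l, hal, hlr⟩ : ∃ l, a ^ 2 < 2 * l ∧ l * r ^ 2 < 1 := by
    have hlim : Filter.Tendsto (fun l => l * r ^ 2) (nhdsWithin (a ^ 2 / 2) (Set.Ioi (a ^ 2 / 2)))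
        (nhds (a ^ 2 / 2 * r ^ 2)) :=
      ((continuous_mul_const (r ^ 2)).tendsto _).mono_left nhdsWithin_le_nhds
    have hlt : a ^ 2 / 2 * r ^ 2 < 1 := by linarith [mul_pow a r 2]
    obtain ⟨l, hlr, hal⟩ := ((hlim.eventually_lt_const hlt).and eventually_mem_nhdsWithin).exists
    exact ⟨l, by linarith [Set.mem_Ioi.1 hal], hlr⟩
  have hl (m : M) : l * axisDistSq o b (f m) < 1 :=
    (mul_le_mul_of_nonneg_left (hr m) (by linarith [sq_nonneg a])).trans_lt hlr
  exact mul_self_eq_zero.1 <|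
    (hmin.mul_acrossRuling_nonpos hal hl hbd (acrossRuling o b a (f m)) m).antisymm
      (mul_self_nonneg _)

end Comparison

/-! ### Helicoidal rectangles in the cylinder -/

section SolidCylinder

variable {o : E3} {b : OrthonormalBasis (Fin 3) ℝ E3} {r h : ℝ}

theorem mem_solidCylinder_iff {p : E3} :
    p ∈ solidCylinder o b r h ↔ axisDistSq o b p ≤ r ^ 2 ∧ height o b p ∈ Set.Icc 0 h := by
  rw [axisDistSq_eq_inner_sq]
  rfl

theorem isClosed_solidCylinder : IsClosed (solidCylinder o b r h) := by
  simp only [solidCylinder, Set.ofPred_and]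
  exact (isClosed_le (by fun_prop) (by fun_prop)).inter
    ((isClosed_le (by fun_prop) (by fun_prop)).inter (isClosed_le (by fun_prop) (by fun_prop)))

theorem convex_solidCylinder : Convex ℝ (solidCylinder o b r h) := by
  intro p ⟨hp, hpz⟩ q ⟨hq, hqz⟩ s t hs ht hst
  have hinner (i : Fin 3) : inner ℝ (b i) (s • p + t • q - o)
      = s • inner ℝ (b i) (p - o) + t • inner ℝ (b i) (q - o) := by
    have hcomb : s • p + t • q - o = s • (p - o) + t • (q - o) := by
      rw [smul_sub, smul_sub, sub_add_sub_comm, ← add_smul, hst, one_smul]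
    rw [hcomb, inner_add_right, real_inner_smul_right, real_inner_smul_right, smul_eq_mul,
      smul_eq_mul]
  have hsq (x y : ℝ) : (s • x + t • y) ^ 2 ≤ s • x ^ 2 + t • y ^ 2 :=
    even_two.convexOn_pow.2 trivial trivial hs ht hst
  refine ⟨?_, by simpa only [hinner, ← Set.mem_Icc] using convex_Icc 0 h hpz hqz hs ht hst⟩
  calc inner ℝ (b 0) (s • p + t • q - o) ^ 2 + inner ℝ (b 1) (s • p + t • q - o) ^ 2
      ≤ s • (inner ℝ (b 0) (p - o) ^ 2 + inner ℝ (b 1) (p - o) ^ 2)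
        + t • (inner ℝ (b 0) (q - o) ^ 2 + inner ℝ (b 1) (q - o) ^ 2) := by
        simp only [hinner, smul_add]
        linarith [hsq (inner ℝ (b 0) (p - o)) (inner ℝ (b 0) (q - o)),
          hsq (inner ℝ (b 1) (p - o)) (inner ℝ (b 1) (q - o))]
    _ ≤ r ^ 2 := convex_Iic (r ^ 2) hp hq hs ht hst

end SolidCylinder

open Topology in
theorem map_nhds_eq_of_injective_fderiv_comp {E F V : Type*}
    [NormedAddCommGroup E] [NormedSpace ℝ E] [FiniteDimensional ℝ E]
    [NormedAddCommGroup F] [NormedSpace ℝ F] [FiniteDimensional ℝ F]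
    [NormedAddCommGroup V] [NormedSpace ℝ V]
    (hdim : Module.finrank ℝ E = Module.finrank ℝ F) {g : E → F} {Ψ : F → V} {w : E}
    (hg : ContDiffAt ℝ 1 g w) (hΨ : DifferentiableAt ℝ Ψ (g w))
    (hinj : Function.Injective (fderiv ℝ (Ψ ∘ g) w)) :
    (𝓝 w).map g = 𝓝 (g w) := by
  have hgs : HasStrictFDerivAt g (fderiv ℝ g w) w := hg.hasStrictFDerivAt one_ne_zero
  rw [fderiv_comp w hΨ hgs.differentiableAt] at hinj
  have hginj : Function.Injective (fderiv ℝ g w : E →ₗ[ℝ] F) := .of_comp hinj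
  exact hgs.map_nhds_eq_of_surj <| LinearMap.range_eq_top.2 <|
    (LinearMap.injective_iff_surjective_of_finrank_eq_finrank hdim).1 hginj

theorem range_eq_of_isOpen_image {X Y : Type*} [TopologicalSpace Y] {g : X → Y} {S : Set X}
    {R : Set Y} (hR : R ⊆ closure (interior R)) (hconn : IsPreconnected (interior R))
    (hgR : Set.range g ⊆ R) (hclosed : IsClosed (Set.range g)) (hS : S.Nonempty)
    (hopen : IsOpen (g '' S)) (hfrontier : g '' Sᶜ ⊆ frontier R) : Set.range g = R := by
  have hint : g '' S ⊆ interior R :=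
    interior_maximal ((Set.image_subset_range g S).trans hgR) hopen
  have hcl : closure (g '' S) ∩ interior R ⊆ g '' S := by
    rintro y ⟨hy, hyR⟩
    obtain ⟨x, rfl⟩ := closure_minimal (Set.image_subset_range g S) hclosed hy
    by_contra hx
    exact (hfrontier ⟨x, fun hxS => hx ⟨x, hxS, rfl⟩, rfl⟩).2 hyR
  obtain ⟨x, hx⟩ := hS
  have hcover : interior R ⊆ g '' S :=
    hconn.subset_of_closure_inter_subset hopen ⟨g x, hint ⟨x, hx, rfl⟩, x, hx, rfl⟩ hcl
  exact hgR.antisymm <| hR.trans <|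
    closure_minimal (hcover.trans (Set.image_subset_range g S)) hclosed

open Topology in
theorem nonempty_interior_of_isManifold {E : Type*} [NormedAddCommGroup E] [NormedSpace ℝ E]
    [FiniteDimensional ℝ E] {H : Type*} [TopologicalSpace H] (I : ModelWithCorners ℝ E H)
    (M : Type*) [TopologicalSpace M] [ChartedSpace H M] {n : WithTop ℕ∞} (hn : n ≠ 0)
    [IsManifold I n M] [Nonempty M] : (I.interior M).Nonempty := by
  obtain ⟨x⟩ := ‹Nonempty M›
  obtain ⟨V, hV, hVt⟩ := mem_nhdsWithin_iff_exists_mem_nhds_inter.1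
    (extChartAt_target_mem_nhdsWithin (I := I) x)
  have hcl : extChartAt I x x ∈ closure (interior (Set.range I)) :=
    I.range_subset_closure_interior (extChartAt_target_subset_range x (mem_extChartAt_target x))
  obtain ⟨y, hyV, hy⟩ := mem_closure_iff_nhds.1 hcl V hV
  have hyt : y ∈ (extChartAt I x).target := hVt ⟨hyV, interior_subset hy⟩
  have hnhds : (extChartAt I x).target ∈ 𝓝 y := by
    have h := extChartAt_target_mem_nhdsWithin_of_mem hyt
    rwa [nhdsWithin_eq_nhds.2 (mem_interior_iff_mem_nhds.1 hy)] at h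
  have hs : (extChartAt I x).symm y ∈ (chartAt H x).source := by
    rw [← extChartAt_source I x]
    exact (extChartAt I x).map_target hyt
  refine ⟨(extChartAt I x).symm y,
    (I.isInteriorPoint_iff_of_mem_atlas hn (chart_mem_atlas H x) hs).2 ?_⟩
  change extChartAt I x ((extChartAt I x).symm y) ∈ interior (extChartAt I x).target
  rw [(extChartAt I x).right_inv hyt]
  exact mem_interior_iff_mem_nhds.2 hnhds

section HelicoidCoordinates

variable (o : E3) (b : OrthonormalBasis (Fin 3) ℝ E3) (a : ℝ)

/-- The parametrization of the helicoid of rate `a` (angle per unit of height) by the signed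
distance from the axis and the height. -/
noncomputable def helicoidParam (q : ℝ × ℝ) : E3 := cylPoint o b q.1 (a * q.2) q.2

/-- The coordinates `(v, z)` along the ruling and along the axis; on the helicoid of rate `a` they
invert `helicoidParam`. -/
noncomputable def helicoidCoord (p : E3) : ℝ × ℝ := (alongRuling o b a p, height o b p)

variable {o b a}

theorem cylPoint_sub (ρ α z : ℝ) :
    cylPoint o b ρ α z - o = ρ • turnedFrame b α 0 + z • turnedFrame b α 2 := by
  rw [cylPoint, turnedFrame_zero, turnedFrame_two]
  module

theorem height_helicoidParam (q : ℝ × ℝ) : height o b (helicoidParam o b a q) = q.2 := by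
  rw [height, helicoidParam, cylPoint_sub, ← turnedFrame_two b (a * q.2), inner_add_right,
    real_inner_smul_right, real_inner_smul_right, OrthonormalBasis.inner_eq_ite,
    OrthonormalBasis.inner_eq_ite]
  simp

theorem inner_rulingFrame_helicoidParam (q : ℝ × ℝ) (i : Fin 3) :
    inner ℝ (rulingFrame o b a (helicoidParam o b a q) i) (helicoidParam o b a q - o)
      = ![q.1, 0, q.2] i := by
  rw [rulingFrame, height_helicoidParam, helicoidParam, cylPoint_sub, inner_add_right,
    real_inner_smul_right, real_inner_smul_right, OrthonormalBasis.inner_eq_ite,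
    OrthonormalBasis.inner_eq_ite]
  fin_cases i <;> simp

theorem acrossRuling_helicoidParam (q : ℝ × ℝ) : acrossRuling o b a (helicoidParam o b a q) = 0 :=
  inner_rulingFrame_helicoidParam q 1

theorem helicoidCoord_helicoidParam (q : ℝ × ℝ) :
    helicoidCoord o b a (helicoidParam o b a q) = q :=
  Prod.ext (inner_rulingFrame_helicoidParam q 0) (height_helicoidParam q)

theorem helicoidParam_helicoidCoord {p : E3} (hp : acrossRuling o b a p = 0) :
    helicoidParam o b a (helicoidCoord o b a p) = p := by
  have hp' : inner ℝ (rulingFrame o b a p 1) (p - o) = 0 := hp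
  refine sub_left_inj.1 (show cylPoint o b (alongRuling o b a p) (a * height o b p) (height o b p)
    - o = p - o from ?_)
  rw [cylPoint_sub, ← rulingFrame, ← (rulingFrame o b a p).sum_repr' (p - o), Fin.sum_univ_three,
    hp', zero_smul, add_zero, inner_rulingFrame_two, alongRuling]

theorem contDiff_helicoidParam {n : WithTop ℕ∞} : ContDiff ℝ n (helicoidParam o b a) := by
  unfold helicoidParam cylPoint
  fun_prop

theorem contDiff_helicoidCoord {n : WithTop ℕ∞} : ContDiff ℝ n (helicoidCoord o b a) := by
  have hz : ContDiff ℝ n (height o b) := contDiff_const.inner ℝ (contDiff_id.sub contDiff_const)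
  unfold helicoidCoord alongRuling rulingFrame
  simp only [turnedFrame_zero]
  exact .prodMk (.inner ℝ (by fun_prop) (by fun_prop)) hz

theorem helicoidParam_div_mul {h : ℝ} (hh : h ≠ 0) (θ ρ s : ℝ) :
    helicoidParam o b (θ / h) (ρ, h * s) = cylPoint o b ρ (θ * s) (h * s) := by
  rw [helicoidParam, ← mul_assoc, div_mul_cancel₀ θ hh]

theorem helicoid_eq_range {h θ : ℝ} (hh : h ≠ 0) :
    helicoid o b h θ = Set.range (helicoidParam o b (θ / h)) := by
  ext p
  constructor
  · rintro ⟨ρ, s, rfl⟩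
    exact ⟨(ρ, h * s), helicoidParam_div_mul hh θ ρ s⟩
  · rintro ⟨⟨ρ, z⟩, rfl⟩
    exact ⟨ρ, z / h, by rw [← helicoidParam_div_mul hh, mul_div_cancel₀ z hh]⟩

theorem helicoidParam_mem_solidCylinder {r h : ℝ} (hr : 0 ≤ r) {q : ℝ × ℝ} :
    helicoidParam o b a q ∈ solidCylinder o b r h ↔ q ∈ Set.Icc (-r) r ×ˢ Set.Icc 0 h := by
  have hv : alongRuling o b a (helicoidParam o b a q) = q.1 := inner_rulingFrame_helicoidParam q 0
  rw [mem_solidCylinder_iff, axisDistSq_eq_along_sq_add_across_sq (a := a), hv,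
    acrossRuling_helicoidParam, zero_pow two_ne_zero, add_zero, height_helicoidParam,
    sq_le_sq, abs_of_nonneg hr, abs_le]
  rfl

theorem compactHelicoid_eq_image {r h θ : ℝ} (hr : 0 ≤ r) (hh : h ≠ 0) :
    compactHelicoid o b r h θ = helicoidParam o b (θ / h) '' (Set.Icc (-r) r ×ˢ Set.Icc 0 h) := by
  rw [compactHelicoid, helicoid_eq_range hh, ← Set.image_univ, ← Set.image_inter_preimage,
    Set.univ_inter]
  exact congrArg _ (Set.ext fun q => helicoidParam_mem_solidCylinder hr)

theorem helicalContour_nonempty {r h θ : ℝ} : (helicalContour o b r h θ).Nonempty :=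
  (((Set.nonempty_Icc.2 zero_le_one).image _).inr : (_ ∪ helix o b r h Real.pi θ).Nonempty)

theorem helicalContour_subset_image_frontier {r h θ : ℝ} (hr : 0 ≤ r) (hh : 0 < h) :
    helicalContour o b r h θ ⊆
      helicoidParam o b (θ / h) '' frontier (Set.Icc (-r) r ×ˢ Set.Icc 0 h) := by
  have hh₀ := hh.ne'
  rw [frontier_prod_eq, frontier_Icc hh.le, frontier_Icc (neg_le_self hr), closure_Icc, closure_Icc]
  have hheight {s : ℝ} (hs : s ∈ Set.Icc (0 : ℝ) 1) : h * s ∈ Set.Icc 0 h :=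
    ⟨mul_nonneg hh.le hs.1, mul_le_of_le_one_right hh.le hs.2⟩
  rintro p (((⟨t, ht, rfl⟩ | ⟨t, ht, rfl⟩) | ⟨s, hs, rfl⟩) | ⟨s, hs, rfl⟩)
  · exact ⟨(t, h), .inl ⟨ht, .inr rfl⟩, by simpa using helicoidParam_div_mul hh₀ θ t 1⟩
  · exact ⟨(t, 0), .inl ⟨ht, .inl rfl⟩, by simpa using helicoidParam_div_mul hh₀ θ t 0⟩
  · exact ⟨(r, h * s), .inr ⟨.inr rfl, hheight hs⟩, by
      simpa using helicoidParam_div_mul hh₀ θ r s⟩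
  · exact ⟨(-r, h * s), .inr ⟨.inl rfl, hheight hs⟩, by
      simpa [cylPoint, add_comm Real.pi] using helicoidParam_div_mul hh₀ θ (-r) s⟩

end HelicoidCoordinates

section HelicoidUniqueness

variable {H : Type*} [TopologicalSpace H] {I : ModelWithCorners ℝ E2 H} {M : Type*}
  [TopologicalSpace M] [ChartedSpace H M] {f : M → E3} {o : E3}
  {b : OrthonormalBasis (Fin 3) ℝ E3} {a : ℝ}

open Topology in
theorem IsMinimalSurface.isOpen_image_interior [IsManifold I 2 M] (hmin : IsMinimalSurface I f)
    (hu : ∀ m, acrossRuling o b a (f m) = 0) :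
    IsOpen ((helicoidCoord o b a ∘ f) '' I.interior M) := by
  rw [isOpen_iff_mem_nhds]
  rintro _ ⟨x, hx, rfl⟩
  let w := extChartAt I x x
  let g := helicoidCoord o b a ∘ f ∘ (extChartAt I x).symm
  have hΨg : helicoidParam o b a ∘ g = f ∘ (extChartAt I x).symm :=
    funext fun y => helicoidParam_helicoidCoord (hu _)
  have hg : ContDiffAt ℝ 1 g w :=
    contDiff_helicoidCoord.contDiffAt.comp w ((hmin.contDiffAt_chart hx).of_le one_le_two)
  have hmap : (𝓝 w).map g = 𝓝 (g w) :=
    map_nhds_eq_of_injective_fderiv_comp (by simp) hg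
      (contDiff_helicoidParam.differentiable one_ne_zero _)
      (hΨg ▸ hmin.injective_fderiv_chart hx)
  have hgw : g w = (helicoidCoord o b a ∘ f) x :=
    congrArg (helicoidCoord o b a ∘ f) (extChartAt_to_inv x)
  have hmem : (extChartAt I x).symm ⁻¹' I.interior M ∈ 𝓝 w := by
    refine (continuousAt_extChartAt_symm x).preimage_mem_nhds ?_
    rw [extChartAt_to_inv]
    exact (I.isOpen_interior (n := 2) two_ne_zero).mem_nhds hx
  rw [← hgw, ← hmap, Filter.mem_map]
  filter_upwards [hmem] with y hy using ⟨_, hy, rfl⟩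

theorem IsMinimalSurface.range_eq_image_helicoidParam [CompactSpace M] [Nonempty M]
    [IsManifold I 2 M] (hmin : IsMinimalSurface I f) {R : Set (ℝ × ℝ)}
    (hR : R ⊆ closure (interior R)) (hconn : IsPreconnected (interior R))
    (hfR : Set.range f ⊆ helicoidParam o b a '' R)
    (hbd : f '' I.boundary M ⊆ helicoidParam o b a '' frontier R) :
    Set.range f = helicoidParam o b a '' R := by
  have hu (m : M) : acrossRuling o b a (f m) = 0 := by
    obtain ⟨q, -, hq⟩ := hfR ⟨m, rfl⟩
    rw [← hq, acrossRuling_helicoidParam]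
  have hΨ : helicoidParam o b a ∘ helicoidCoord o b a ∘ f = f :=
    funext fun m => helicoidParam_helicoidCoord (hu m)
  have hcoord {S : Set (ℝ × ℝ)} {T : Set M} (h : f '' T ⊆ helicoidParam o b a '' S) :
      helicoidCoord o b a ∘ f '' T ⊆ S := by
    rintro _ ⟨m, hm, rfl⟩
    obtain ⟨q, hq, hqm⟩ := h ⟨m, hm, rfl⟩
    rwa [Function.comp_apply, ← hqm, helicoidCoord_helicoidParam]
  have hcont : Continuous (helicoidCoord o b a ∘ f) :=
    (contDiff_helicoidCoord (n := 0)).continuous.comp hmin.continuous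
  have hrange : Set.range (helicoidCoord o b a ∘ f) = R := by
    refine range_eq_of_isOpen_image hR hconn ?_ (isCompact_range hcont).isClosed
      (nonempty_interior_of_isManifold I M two_ne_zero) (hmin.isOpen_image_interior hu) ?_
    · simpa only [Set.image_univ] using hcoord (T := Set.univ) (by rwa [Set.image_univ])
    · exact hcoord (by rwa [I.compl_interior])
  rw [← hrange, ← Set.range_comp, hΨ]

theorem IsMinimalSurface.range_subset_compactHelicoid [CompactSpace M]
    (hmin : IsMinimalSurface I f) {r h θ : ℝ} (hr : 0 ≤ r) (hh : 0 < h)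
    (hspan : f '' I.boundary M ⊆ helicalContour o b r h θ) (hθ : (θ * r) ^ 2 < 2 * h ^ 2) :
    Set.range f ⊆ compactHelicoid o b r h θ := by
  have hbd : f '' I.boundary M ⊆ compactHelicoid o b r h θ := by
    rw [compactHelicoid_eq_image hr hh.ne']
    exact (hspan.trans (helicalContour_subset_image_frontier hr hh)).trans
      (Set.image_mono (isClosed_Icc.prod isClosed_Icc).frontier_subset)
  have hcyl : Set.range f ⊆ solidCylinder o b r h :=
    hmin.range_subset_of_convex convex_solidCylinder isClosed_solidCylinder
      (hbd.trans Set.inter_subset_right)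
  have har : (θ / h * r) ^ 2 < 2 := by
    rwa [div_mul_eq_mul_div, div_pow, div_lt_iff₀ (pow_pos hh 2)]
  rw [compactHelicoid, helicoid_eq_range hh.ne'] at hbd ⊢
  refine Set.subset_inter ?_ hcyl
  rintro _ ⟨m, rfl⟩
  refine ⟨_, helicoidParam_helicoidCoord (hmin.acrossRuling_eq_zero har
    (fun y => (mem_solidCylinder_iff.1 (hcyl ⟨y, rfl⟩)).1) (fun y hy => ?_) m)⟩
  obtain ⟨q, hq⟩ := (hbd ⟨y, hy, rfl⟩).1
  rw [← hq, acrossRuling_helicoidParam]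

end HelicoidUniqueness

theorem theorem2p2_general
    {H : Type*} [TopologicalSpace H] (I : ModelWithCorners ℝ E2 H)
    {M : Type*} [TopologicalSpace M] [CompactSpace M] [Nonempty M] [ChartedSpace H M]
    [IsManifold I 2 M]
    (o : E3) (b : OrthonormalBasis (Fin 3) ℝ E3) (r h θ : ℝ) (hr : 0 < r) (hh : 0 < h)
    (f : M → E3) (hmin : IsMinimalSurface I f)
    (hspan : f '' I.boundary M ⊆ helicalContour o b r h θ)
    (hθ : (θ * r) ^ 2 < 2 * h ^ 2) :
    Set.range f = compactHelicoid o b r h θ := by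
  have hint : interior (Set.Icc (-r) r ×ˢ Set.Icc 0 h) = Set.Ioo (-r) r ×ˢ Set.Ioo 0 h := by
    rw [interior_prod_eq, interior_Icc, interior_Icc]
  have hsub := hmin.range_subset_compactHelicoid hr.le hh hspan hθ
  rw [compactHelicoid_eq_image hr.le hh.ne'] at hsub ⊢
  refine hmin.range_eq_image_helicoidParam ?_ ?_ hsub
    (hspan.trans (helicalContour_subset_image_frontier hr.le hh))
  · rw [hint, closure_prod_eq, closure_Ioo (neg_lt_self hr).ne, closure_Ioo hh.ne]
  · exact hint ▸ isPreconnected_Ioo.prod isPreconnected_Ioo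

theorem theorem2p2
    {H : Type*} [TopologicalSpace H] (I : ModelWithCorners ℝ E2 H)
    {M : Type*} [TopologicalSpace M] [T2Space M] [CompactSpace M] [ChartedSpace H M]
    [IsManifold I 2 M]
    (o : E3) (b : OrthonormalBasis (Fin 3) ℝ E3) (r h θ : ℝ) (hr : 0 < r) (hh : 0 < h)
    (f : M → E3) (hmin : IsMinimalSurface I f)
    (hC : Set.range f ⊆ solidCylinder o b r h)
    (hspan : f '' I.boundary M = helicalContour o b r h θ)
    (hθ₀ : 0 ≤ θ) (hθ : θ ≤ h / r) :
    Set.range f = compactHelicoid o b r h θ := by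
  have hne : (f '' I.boundary M).Nonempty := hspan ▸ helicalContour_nonempty
  have : Nonempty M := hne.of_image.to_type
  have hθr : (θ * r) ^ 2 ≤ h ^ 2 :=
    pow_le_pow_left₀ (mul_nonneg hθ₀ hr.le) ((le_div_iff₀ hr).1 hθ) 2
  exact theorem2p2_general I o b r h θ hr hh f hmin hspan.subset (by linarith [pow_pos hh 2])
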